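/- Let $\mathbb D=\{|z|<1\}$. For a proper simply connected domain $\Omega\subsetneq\mathbb C$ with conformal mapping $\varphi$ of $\Omega$ onto $\mathbb D$, let $\lambda_\Omega(z)=|\varphi'(z)|/(1-|\varphi(z)|^2)$ be its hyperbolic density (independent of $\varphi$). For a harmonic mapping $f=h+\overline g$ in $\Omega\ni 0$, with $h,g$ analytic in $\Omega$ and $g(0)=0$, and for $\alpha>0$, put $$\|f\|_{\mathcal H,\Omega}(\alpha)=|f(0)|+\sup_{z\in\Omega}\frac{|h'(z)|+|g'(z)|}{\lambda_\Omega(z)^{\alpha}}\in[0,\infty].$$ **Theorem.** Let $\alpha>0$, $M>0$, let $\Omega$ be a proper simply connected domain with $\mathbb D\subseteq\Omega$, and let $f=h+\overline g$ be a harmonic mapping in $\Omega$ with $f(0)=0$, $\|f\|_{\mathcal H,\Omega}(\alpha)\le M$, and $h(z)=\sum_{n\ge1}a_nz^n$, $g(z)=\sum_{n\ge1}b_nz^n$ in $\mathbb D$. Then for all $n\ge1$ $$|a_n|^2+|b_n|^2\le A_n(\Omega,M):=\frac{M^2}{n^2}\inf_{0<t<1}\frac1{2\pi t\,t^{2(n-1)}}\int_{|z|=t}\lambda_\Omega(z)^{2\alpha}\,|dz|,$$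 where the integrals are finite, and hence $|a_n|+|b_n|\le\sqrt{2A_n(\Omega,M)}$. In particular: 1. If $\Omega=\Omega_\gamma:=\{z:|z+\frac{\gamma}{1-\gamma}|<\frac1{1-\gamma}\}$ with $0\le\gamma<1$, then for all $n\ge1$ $$|a_n|^2+|b_n|^2\le C_n(\alpha,\gamma,M):=\frac{M^2}{n^2}\inf_{0<t<1}\frac{(1-\gamma)^{2\alpha}}{t^{2(n-1)}\bigl(1-((1-\gamma)t+\gamma)^2\bigr)^{2\alpha}}.$$ 2. If $\Omega=\mathbb D$, then $|a_n|^2+|b_n|^2\le C_n(\alpha,M):=C_n(\alpha,0,M)$ for all $n\ge1$. If $0<\alpha<1$, then $\lim_{n\to\infty}C_n(\alpha,M)=0$. If $\alpha\ge1$, then for all $n\ge1$ $$C_n(\alpha,M)\le\frac{M^2}{(2\alpha)^{2\alpha}}\Bigl(1+\frac{2\alpha}{n-1}\Bigr)^{n-1}\frac{(n-1+2\alpha)^{2\alpha}}{n^2},$$ where for $n=1$ the factor $(1+\frac{2\alpha}{n-1})^{n-1}$ is read as $1$; the right-hand side, and hence $C_n(\alpha,M)$, is $O(n^{2\alpha-2})$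 as $n\to\infty$. -/

import Mathlib

open Set Filter Topology Metric MeasureTheory
open scoped ENNReal ComplexConjugate

noncomputable section

/-- `φ` restricts to a conformal (bijective holomorphic) mapping of `Ω` onto the open unit disk. -/
def IsConformalOntoDisk (φ : ℂ → ℂ) (Ω : Set ℂ) : Prop :=
  DifferentiableOn ℂ φ Ω ∧ BijOn φ Ω (ball 0 1)

/-- The hyperbolic density `1 / (1 - |z|²)` of the unit disk. -/
def diskDensity (z : ℂ) : ℝ := 1 / (1 - ‖z‖ ^ 2)

open Classical in
/-- The hyperbolic density `λ_Ω(z) = λ_𝔻(φ z) |φ' z|` of a proper simply connected domain `Ω`, where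
`φ` is a conformal mapping of `Ω` onto the unit disk. On `Ω` the value does not depend on the
mapping chosen. Such a mapping exists for every proper simply connected domain; the value `0` is
only used for sets which admit no conformal mapping onto the disk. -/
def hyperbolicDensity (Ω : Set ℂ) (z : ℂ) : ℝ :=
  if h : ∃ φ : ℂ → ℂ, IsConformalOntoDisk φ Ω then
    diskDensity (h.choose z) * ‖deriv h.choose z‖
  else 0

/-- `f` is a harmonic mapping in `Ω` with canonical decomposition `f = h + conj g`, where `h`, `g`
are analytic in `Ω` and `g 0 = 0`. -/
structure IsHarmonicMapping (Ω : Set ℂ) (f h g : ℂ → ℂ) : Prop where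
  harmonic : InnerProductSpace.HarmonicOnNhd f Ω
  analytic_h : DifferentiableOn ℂ h Ω
  analytic_g : DifferentiableOn ℂ g Ω
  g_zero : g 0 = 0
  decomp : ∀ z ∈ Ω, f z = h z + conj (g z)

/-- The Bloch semi-norm `β(α) = sup_{z ∈ Ω} (|h' z| + |g' z|) / λ_Ω(z) ^ α`
with values in `[0, ∞]`. -/
def blochSeminorm (Ω : Set ℂ) (α : ℝ) (h g : ℂ → ℂ) : ℝ≥0∞ :=
  ⨆ z ∈ Ω, (‖deriv h z‖ₑ + ‖deriv g z‖ₑ) / ENNReal.ofReal (hyperbolicDensity Ω z ^ α)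

/-- The Bloch norm `|f 0| + β(α)` of `f = h + conj g`, with values in `[0, ∞]`; the mapping `f` is
a harmonic `α`-Bloch mapping in `Ω` exactly when it is finite. -/
def blochNorm (Ω : Set ℂ) (α : ℝ) (f h g : ℂ → ℂ) : ℝ≥0∞ :=
  ‖f 0‖ₑ + blochSeminorm Ω α h g

/-- `u z = ∑_{n ≥ 1} c n * z ^ n` for all `z` in the unit disk. The value `c 0` is irrelevant. -/
def HasDiskExpansion (u : ℂ → ℂ) (c : ℕ → ℂ) : Prop :=
  ∀ z ∈ ball (0 : ℂ) 1, HasSum (fun n : ℕ => c (n + 1) * z ^ (n + 1)) (u z)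

/-- The arc length integral `∫_{|z| = t} u(z) |dz|`, for `t > 0`. -/
def circleArcIntegral (u : ℂ → ℝ) (t : ℝ) : ℝ :=
  ∫ θ in (0 : ℝ)..(2 * Real.pi), u (circleMap 0 t θ) * t

/-- `A_n(Ω, M) = (M² / n²) inf_{0 < t < 1} (2π t t^{2(n-1)})⁻¹ ∫_{|z| = t} λ_Ω(z)^{2α} |dz|`,
for `n ≥ 1`. -/
def coeffBound (Ω : Set ℂ) (α M : ℝ) (n : ℕ) : ℝ :=
  M ^ 2 / (n : ℝ) ^ 2 *
    ⨅ t : Ioo (0 : ℝ) 1, 1 / (2 * Real.pi * (t : ℝ) * (t : ℝ) ^ (2 * (n - 1))) *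
      circleArcIntegral (fun z => hyperbolicDensity Ω z ^ (2 * α)) t

/-- The disk `Ω_γ = {z : |z + γ / (1 - γ)| < 1 / (1 - γ)}`. -/
def shiftedDisk (γ : ℝ) : Set ℂ :=
  {z : ℂ | ‖z + ((γ / (1 - γ) : ℝ) : ℂ)‖ < 1 / (1 - γ)}

/-- `C_n(α, γ, M) =
(M² / n²) inf_{0 < t < 1} (1-γ)^{2α} / (t^{2(n-1)} (1 - ((1-γ) t + γ)²)^{2α})`, for `n ≥ 1`. -/
def coeffBoundShifted (α γ M : ℝ) (n : ℕ) : ℝ :=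
  M ^ 2 / (n : ℝ) ^ 2 *
    ⨅ t : Ioo (0 : ℝ) 1, (1 - γ) ^ (2 * α) /
      ((t : ℝ) ^ (2 * (n - 1)) * (1 - ((1 - γ) * (t : ℝ) + γ) ^ 2) ^ (2 * α))

/-- `M² / (2α)^{2α} * (1 + 2α / (n-1))^{n-1} * (n-1+2α)^{2α} / n²`, for `n ≥ 1`. For `n = 1` the
middle factor has exponent `0` and equals `1`. -/
def explicitDiskBound (α M : ℝ) (n : ℕ) : ℝ :=
  M ^ 2 / (2 * α) ^ (2 * α) * (1 + 2 * α / ((n : ℝ) - 1)) ^ (n - 1) *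
    (((n : ℝ) - 1 + 2 * α) ^ (2 * α) / (n : ℝ) ^ 2)

end

/-! The Taylor coefficients of `h'` and `g'` are controlled by circle means. Cauchy's formula bounds
n|a_n|t^(n-1) and n|b_n|t^(n-1) by the means of |h'| and |g'| over |z| = t; adding them and using
the Bloch bound gives n(|a_n|+|b_n|)t^(n-1) ≤ M · mean(λ^α). Jensen's inequality turns the square of
the right side into M² · mean(λ^(2α)) (`sq_norm_coeff_add_le`). This controls (|a_n|+|b_n|)², which
is more than the sum of squares.

For Ω_γ only an upper bound on λ is needed. Schwarz–Pick, applied to an explicit map of the disk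
onto Ω_γ centred at z, provides it (`hyperbolicDensity_shiftedDisk_le`), whichever conformal mapping
defines λ. On |z| = t the bound is largest at z = t.

For the unit disk, t² = (n-1)/(n-1+2α) yields the explicit bound, and (1+2α/(n-1))^(n-1) ≤ e^(2α)
gives its order n^(2α-2). The same order gives the limit 0 when α < 1. -/

/-! ### Taylor coefficients of functions with a power series expansion in the disk -/

/-- A disk expansion is a power series expansion on the unit ball. -/
theorem HasDiskExpansion.hasFPowerSeriesOnBall {u : ℂ → ℂ} {c : ℕ → ℂ}
    (hu : HasDiskExpansion u c) :
    HasFPowerSeriesOnBall u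
      (FormalMultilinearSeries.ofScalars ℂ fun n => if n = 0 then 0 else c n) 0 1 where
  r_le := by
    refine ENNReal.le_of_forall_nnreal_lt fun r hr => ?_
    have hr1 : (r : ℝ) < 1 := by exact_mod_cast hr
    -- Convergence at the real point r makes the terms tend to 0 there, so r is at most the radius.
    have hs := (hu (r : ℂ) (by simpa using hr1)).summable.tendsto_atTop_zero.norm
    refine FormalMultilinearSeries.le_radius_of_tendsto _ (l := 0) ?_
    rw [← tendsto_add_atTop_iff_nat 1]
    simpa using hs
  r_pos := one_pos
  hasSum := by
    intro y hy
    have hy' : y ∈ ball (0 : ℂ) 1 := by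
      rwa [← ENNReal.ofReal_one, Metric.eball_ofReal] at hy
    rw [← hasSum_nat_add_iff' 1]
    simpa [FormalMultilinearSeries.ofScalars_apply_eq, mul_comm] using hu y hy'

theorem HasDiskExpansion.differentiableOn {u : ℂ → ℂ} {c : ℕ → ℂ} (hu : HasDiskExpansion u c) :
    DifferentiableOn ℂ u (ball 0 1) := by
  have := hu.hasFPowerSeriesOnBall.differentiableOn
  rwa [← ENNReal.ofReal_one, Metric.eball_ofReal] at this

/-- Power series at a point are unique, so the expansion is the Taylor series of `u`;
differentiating shifts the index. -/
theorem HasDiskExpansion.coeff_succ_eq {u : ℂ → ℂ} {c : ℕ → ℂ} (hu : HasDiskExpansion u c)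
    (k : ℕ) : iteratedDeriv k (deriv u) 0 / (k.factorial : ℂ) = (k + 1) * c (k + 1) := by
  have h1 := hu.hasFPowerSeriesOnBall.hasFPowerSeriesAt
  have h2 := h1.analyticAt.hasFPowerSeriesAt
  have h3 := congrArg (fun p : FormalMultilinearSeries ℂ ℂ ℂ => p.coeff (k + 1))
    (h1.eq_formalMultilinearSeries h2)
  simp only [FormalMultilinearSeries.coeff_ofScalars, Nat.succ_ne_zero, if_false] at h3
  rw [h3, ← iteratedDeriv_succ', Nat.factorial_succ]
  have := Nat.cast_ne_zero (R := ℂ).2 k.factorial_ne_zero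
  have : (k + 1 : ℂ) ≠ 0 := Nat.cast_add_one_ne_zero k
  push_cast
  field_simp

/-- Cauchy's estimate in `L¹` form for the Taylor coefficients at the origin. -/
theorem norm_iteratedDeriv_div_factorial_mul_pow_le {v : ℂ → ℂ} {t : ℝ} (ht : 0 < t)
    (hv : DifferentiableOn ℂ v (closedBall 0 t)) (k : ℕ) :
    ‖iteratedDeriv k v 0 / (k.factorial : ℂ)‖ * t ^ k ≤
      (2 * Real.pi)⁻¹ * ∫ θ in (0 : ℝ)..(2 * Real.pi), ‖v (circleMap 0 t θ)‖ := by
  lift t to NNReal using ht.le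
  have ht' : 0 < t := by exact_mod_cast ht
  have h1 := (hv.hasFPowerSeriesOnBall ht').hasFPowerSeriesAt
  have h2 := h1.analyticAt.hasFPowerSeriesAt
  have h3 := congrArg (fun p : FormalMultilinearSeries ℂ ℂ ℂ => p k fun _ => 1)
    -- Uniqueness identifies the Cauchy integral series with the Taylor series.
    (h1.eq_formalMultilinearSeries h2)
  simp only [FormalMultilinearSeries.ofScalars_apply_eq, one_pow, smul_eq_mul, mul_one,
    cauchyPowerSeries_apply, circleIntegral] at h3
  rw [← h3, norm_mul, norm_inv, mul_assoc, mul_comm ‖_‖ ((t : ℝ) ^ k)]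
  have hpi : ‖(2 * Real.pi * Complex.I : ℂ)‖ = 2 * Real.pi := by
    simp [abs_of_pos Real.pi_pos]
  rw [hpi]
  refine mul_le_mul_of_nonneg_left ?_ (by positivity)
  refine (mul_le_mul_of_nonneg_left (intervalIntegral.norm_integral_le_integral_norm
    (by positivity)) (by positivity)).trans_eq ?_
  rw [← intervalIntegral.integral_const_mul]
  congr 1
  ext θ
  have : (t : ℝ) ≠ 0 := ht.ne'
  simp only [deriv_circleMap, norm_mul, norm_circleMap_zero, Complex.norm_I, norm_pow, norm_inv,
    norm_div, norm_one, sub_zero, NNReal.abs_eq, mul_one]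
  field_simp
  rw [← mul_pow, mul_one_div_cancel this, one_pow, one_mul]

theorem HasDiskExpansion.norm_coeff_succ_mul_pow_le {u : ℂ → ℂ} {c : ℕ → ℂ}
    (hu : HasDiskExpansion u c) {t : ℝ} (ht : t ∈ Ioo (0 : ℝ) 1) (k : ℕ) :
    (k + 1) * ‖c (k + 1)‖ * t ^ k ≤
      (2 * Real.pi)⁻¹ * ∫ θ in (0 : ℝ)..(2 * Real.pi), ‖deriv u (circleMap 0 t θ)‖ := by
  have hd : DifferentiableOn ℂ (deriv u) (closedBall 0 t) :=
    (hu.differentiableOn.deriv isOpen_ball).mono (closedBall_subset_ball ht.2)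
  have h := norm_iteratedDeriv_div_factorial_mul_pow_le ht.1 hd k
  rw [hu.coeff_succ_eq, norm_mul] at h
  have hk : ‖(k + 1 : ℂ)‖ = k + 1 := by exact_mod_cast Complex.norm_natCast (k + 1)
  rwa [hk] at h

/-- Jensen's inequality for the square of a mean value over `[0, 2π]`. -/
theorem sq_circle_average_le {w : ℝ → ℝ} (hw : Continuous w) :
    ((2 * Real.pi)⁻¹ * ∫ θ in (0 : ℝ)..(2 * Real.pi), w θ) ^ 2 ≤
      (2 * Real.pi)⁻¹ * ∫ θ in (0 : ℝ)..(2 * Real.pi), w θ ^ 2 := by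
  set m := (2 * Real.pi)⁻¹ * ∫ θ in (0 : ℝ)..(2 * Real.pi), w θ with hm
  have hpi : 0 < 2 * Real.pi := by positivity
  have hI : ∫ θ in (0 : ℝ)..(2 * Real.pi), w θ = 2 * Real.pi * m := by
    rw [hm, mul_inv_cancel_left₀ hpi.ne']
  -- The variance of `w` about its mean is nonnegative; expanding it gives the claim.
  have h0 : 0 ≤ ∫ θ in (0 : ℝ)..(2 * Real.pi), (w θ - m) ^ 2 :=
    intervalIntegral.integral_nonneg hpi.le fun θ _ => sq_nonneg _
  have h1 : ∫ θ in (0 : ℝ)..(2 * Real.pi), (w θ - m) ^ 2 =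
      (∫ θ in (0 : ℝ)..(2 * Real.pi), w θ ^ 2) - 2 * Real.pi * m ^ 2 := by
    have e : (fun θ => (w θ - m) ^ 2) = fun θ => (w θ ^ 2 - 2 * m * w θ) + m ^ 2 := by
      ext θ; ring
    rw [e, intervalIntegral.integral_add, intervalIntegral.integral_sub,
      intervalIntegral.integral_const_mul, hI, intervalIntegral.integral_const]
    · simp only [sub_zero, smul_eq_mul]
      ring
    all_goals exact Continuous.intervalIntegrable (by fun_prop) _ _
  rw [le_inv_mul_iff₀ hpi]
  linarith

/-! ### The hyperbolic density -/

theorem hyperbolicDensity_nonneg {Ω : Set ℂ} {z : ℂ} (hz : z ∈ Ω) : 0 ≤ hyperbolicDensity Ω z := by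
  unfold hyperbolicDensity
  split_ifs with h
  · have h1 : ‖h.choose z‖ < 1 := by simpa using h.choose_spec.2.mapsTo hz
    have : 0 ≤ 1 - ‖h.choose z‖ ^ 2 := by nlinarith [norm_nonneg (h.choose z)]
    unfold diskDensity
    positivity
  · exact le_rfl

theorem continuousOn_hyperbolicDensity {Ω : Set ℂ} (hΩ : IsOpen Ω) :
    ContinuousOn (hyperbolicDensity Ω) Ω := by
  unfold hyperbolicDensity
  split_ifs with h
  · have hd := h.choose_spec.1
    refine ContinuousOn.mul ?_ (hd.deriv hΩ).continuousOn.norm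
    unfold diskDensity
    refine continuousOn_const.div (continuousOn_const.sub (hd.continuousOn.norm.pow 2)) ?_
    intro z hz
    have h1 : ‖h.choose z‖ < 1 := by simpa using h.choose_spec.2.mapsTo hz
    nlinarith [norm_nonneg (h.choose z)]
  · exact continuousOn_const

theorem circleMap_mem_ball_one {t : ℝ} (ht : t ∈ Ioo (0 : ℝ) 1) (θ : ℝ) :
    circleMap 0 t θ ∈ ball (0 : ℂ) 1 := by
  simpa [abs_of_pos ht.1] using ht.2

theorem continuous_hyperbolicDensity_circleMap_rpow {Ω : Set ℂ} (hΩ : IsOpen Ω)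
    (hsub : ball (0 : ℂ) 1 ⊆ Ω) {t : ℝ} (ht : t ∈ Ioo (0 : ℝ) 1) {p : ℝ} (hp : 0 ≤ p) :
    Continuous fun θ : ℝ => hyperbolicDensity Ω (circleMap 0 t θ) ^ p :=
  ((continuousOn_hyperbolicDensity hΩ).comp_continuous (continuous_circleMap 0 t)
    fun θ => hsub (circleMap_mem_ball_one ht θ)).rpow_const fun _ => Or.inr hp

/-! ### Coefficient estimates from the Bloch norm -/

/-- A finite Bloch norm bounds the derivatives pointwise by a power of the hyperbolic density. -/
theorem norm_deriv_add_norm_deriv_le_of_blochNorm_le {Ω : Set ℂ} {α M : ℝ} {f h g : ℂ → ℂ}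
    (hM : 0 < M) (hB : blochNorm Ω α f h g ≤ ENNReal.ofReal M) {z : ℂ} (hz : z ∈ Ω) :
    ‖deriv h z‖ + ‖deriv g z‖ ≤ M * hyperbolicDensity Ω z ^ α := by
  have h1 : (‖deriv h z‖ₑ + ‖deriv g z‖ₑ) / ENNReal.ofReal (hyperbolicDensity Ω z ^ α) ≤
      ENNReal.ofReal M :=
    (le_iSup₂ (f := fun z (_ : z ∈ Ω) => (‖deriv h z‖ₑ + ‖deriv g z‖ₑ) /
      ENNReal.ofReal (hyperbolicDensity Ω z ^ α)) z hz).trans (le_add_self.trans hB)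
  -- No positivity of the density is needed: in `ℝ≥0∞` a nonzero numerator over 0 is ∞, which the
  -- finite bound excludes.
  rw [ENNReal.div_le_iff_le_mul (Or.inr ENNReal.ofReal_ne_top) (Or.inl ENNReal.ofReal_ne_top),
    ← ENNReal.ofReal_mul hM.le, ← ofReal_norm, ← ofReal_norm,
    ← ENNReal.ofReal_add (norm_nonneg _) (norm_nonneg _)] at h1
  exact (ENNReal.ofReal_le_ofReal_iff (mul_nonneg hM.le
    (Real.rpow_nonneg (hyperbolicDensity_nonneg hz) α))).1 h1

/-- The coefficient estimate on a single circle `|z| = t`. -/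
theorem sq_norm_coeff_add_le {Ω : Set ℂ} (hΩ : IsOpen Ω) (hsub : ball (0 : ℂ) 1 ⊆ Ω)
    {α M : ℝ} (hα : 0 < α) (hM : 0 < M) {f h g : ℂ → ℂ} {a b : ℕ → ℂ}
    (hB : blochNorm Ω α f h g ≤ ENNReal.ofReal M)
    (ha : HasDiskExpansion h a) (hb : HasDiskExpansion g b) {t : ℝ} (ht : t ∈ Ioo (0 : ℝ) 1)
    (k : ℕ) :
    (((k : ℝ) + 1) * (‖a (k + 1)‖ + ‖b (k + 1)‖) * t ^ k) ^ 2 ≤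
      M ^ 2 * ((2 * Real.pi)⁻¹ * ∫ θ in (0 : ℝ)..(2 * Real.pi),
        hyperbolicDensity Ω (circleMap 0 t θ) ^ (2 * α)) := by
  have ht0 : 0 < t := ht.1
  have hpi : 0 < 2 * Real.pi := by positivity
  have hderiv {u : ℂ → ℂ} {c : ℕ → ℂ} (hu : HasDiskExpansion u c) :
      Continuous fun θ : ℝ => ‖deriv u (circleMap 0 t θ)‖ :=
    ((hu.differentiableOn.deriv isOpen_ball).continuousOn.comp_continuous
      (continuous_circleMap 0 t) (circleMap_mem_ball_one ht)).norm
  have hc := continuous_hyperbolicDensity_circleMap_rpow hΩ hsub ht hα.le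
  have h1 : ((k : ℝ) + 1) * (‖a (k + 1)‖ + ‖b (k + 1)‖) * t ^ k ≤
      M * ((2 * Real.pi)⁻¹ * ∫ θ in (0 : ℝ)..(2 * Real.pi),
        hyperbolicDensity Ω (circleMap 0 t θ) ^ α) := by
    have h2 : (∫ θ in (0 : ℝ)..(2 * Real.pi), (‖deriv h (circleMap 0 t θ)‖ +
        ‖deriv g (circleMap 0 t θ)‖)) ≤
        ∫ θ in (0 : ℝ)..(2 * Real.pi), M * hyperbolicDensity Ω (circleMap 0 t θ) ^ α :=
      intervalIntegral.integral_mono_on hpi.le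
        (((hderiv ha).add (hderiv hb)).intervalIntegrable _ _)
        ((hc.const_mul M).intervalIntegrable _ _) fun θ _ =>
          norm_deriv_add_norm_deriv_le_of_blochNorm_le hM hB (hsub (circleMap_mem_ball_one ht θ))
    rw [intervalIntegral.integral_const_mul, intervalIntegral.integral_add
      ((hderiv ha).intervalIntegrable _ _) ((hderiv hb).intervalIntegrable _ _)] at h2
    have h3 := mul_le_mul_of_nonneg_left h2 (inv_nonneg.2 hpi.le)
    linarith [ha.norm_coeff_succ_mul_pow_le ht k, hb.norm_coeff_succ_mul_pow_le ht k]
  refine (pow_le_pow_left₀ (by positivity) h1 2).trans ?_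
  rw [mul_pow]
  refine mul_le_mul_of_nonneg_left ((sq_circle_average_le hc).trans_eq ?_) (sq_nonneg M)
  congr 2
  ext θ
  rw [← Real.rpow_natCast, ← Real.rpow_mul
    (hyperbolicDensity_nonneg (hsub (circleMap_mem_ball_one ht θ)))]
  norm_num [mul_comm]

/-- To bound a quantity by `c` times an infimum over `t ∈ (0, 1)`, bound it for every `t`. -/
theorem le_mul_iInf_Ioo {x c : ℝ} (hc : 0 ≤ c) {F : ℝ → ℝ}
    (hF : ∀ t ∈ Ioo (0 : ℝ) 1, x ≤ c * F t) : x ≤ c * ⨅ t : Ioo (0 : ℝ) 1, F t := by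
  have : Nonempty (Ioo (0 : ℝ) 1) := ⟨⟨1 / 2, by norm_num⟩⟩
  rw [Real.mul_iInf_of_nonneg hc]
  exact le_ciInf fun t => hF t t.2

theorem sq_norm_coeff_add_le_coeffBound {Ω : Set ℂ} (hΩ : IsOpen Ω) (hsub : ball (0 : ℂ) 1 ⊆ Ω)
    {α M : ℝ} (hα : 0 < α) (hM : 0 < M) {f h g : ℂ → ℂ} {a b : ℕ → ℂ}
    (hB : blochNorm Ω α f h g ≤ ENNReal.ofReal M)
    (ha : HasDiskExpansion h a) (hb : HasDiskExpansion g b) {n : ℕ} (hn : 1 ≤ n) :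
    (‖a n‖ + ‖b n‖) ^ 2 ≤ coeffBound Ω α M n := by
  obtain ⟨k, rfl⟩ := Nat.exists_eq_add_of_le' hn
  refine le_mul_iInf_Ioo (F := fun t => 1 / (2 * Real.pi * t * t ^ (2 * (k + 1 - 1))) *
      circleArcIntegral (fun z => hyperbolicDensity Ω z ^ (2 * α)) t) (by positivity) ?_
  intro t ht
  have ht0 : 0 < t := ht.1
  have h1 := sq_norm_coeff_add_le hΩ hsub hα hM hB ha hb ht k
  rw [circleArcIntegral, intervalIntegral.integral_mul_const]
  set I := ∫ θ in (0 : ℝ)..(2 * Real.pi), hyperbolicDensity Ω (circleMap 0 t θ) ^ (2 * α)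
  have hk : (0 : ℝ) < k + 1 := by positivity
  have e : M ^ 2 / ((k + 1 : ℕ) : ℝ) ^ 2 *
      (1 / (2 * Real.pi * t * t ^ (2 * (k + 1 - 1))) * (I * t)) =
      M ^ 2 * ((2 * Real.pi)⁻¹ * I) / ((k + 1) * t ^ k) ^ 2 := by
    rw [Nat.add_sub_cancel, pow_mul']
    push_cast
    field_simp
  rw [e, le_div_iff₀ (by positivity)]
  linarith

theorem sq_add_sq_le_sq_norm_add (x y : ℂ) : ‖x‖ ^ 2 + ‖y‖ ^ 2 ≤ (‖x‖ + ‖y‖) ^ 2 := by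
  nlinarith [norm_nonneg x, norm_nonneg y]

/-! ### A Schwarz–Pick estimate for the hyperbolic density -/

/-- The identity behind the disk automorphisms: its right side is positive when both points lie in
the disk. -/
theorem norm_one_add_conj_mul_sq_sub (a x : ℂ) :
    ‖1 + conj a * x‖ ^ 2 - ‖x + a‖ ^ 2 = (1 - ‖a‖ ^ 2) * (1 - ‖x‖ ^ 2) := by
  simp only [Complex.sq_norm, Complex.normSq_apply, Complex.add_re, Complex.add_im, Complex.mul_re,
    Complex.mul_im, Complex.conj_re, Complex.conj_im, Complex.one_re, Complex.one_im]
  ring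

theorem one_add_conj_mul_ne_zero {a x : ℂ} (ha : ‖a‖ < 1) (hx : ‖x‖ < 1) :
    1 + conj a * x ≠ 0 := by
  intro h
  have h1 : ‖conj a * x‖ < 1 := by
    rw [norm_mul, RCLike.norm_conj]
    nlinarith [norm_nonneg a, norm_nonneg x]
  rw [eq_neg_of_add_eq_zero_right h] at h1
  simp at h1

/-- The automorphism `x ↦ (x + a) / (1 + conj a * x)` of the unit disk, which maps `0` to `a`. -/
noncomputable def diskShift (a x : ℂ) : ℂ := (x + a) / (1 + conj a * x)

theorem norm_diskShift_lt_one {a x : ℂ} (ha : ‖a‖ < 1) (hx : ‖x‖ < 1) : ‖diskShift a x‖ < 1 := by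
  have hne := one_add_conj_mul_ne_zero ha hx
  rw [diskShift, norm_div, div_lt_one (norm_pos_iff.2 hne)]
  refine lt_of_pow_lt_pow_left₀ 2 (norm_nonneg _) ?_
  have h1 : 0 < (1 - ‖a‖ ^ 2) * (1 - ‖x‖ ^ 2) :=
    mul_pos (by nlinarith [norm_nonneg a]) (by nlinarith [norm_nonneg x])
  linarith [norm_one_add_conj_mul_sq_sub a x]

theorem hasDerivAt_diskShift {a x : ℂ} (ha : ‖a‖ < 1) (hx : ‖x‖ < 1) :
    HasDerivAt (diskShift a) (((1 - ‖a‖ ^ 2 : ℝ) : ℂ) / (1 + conj a * x) ^ 2) x := by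
  have h := ((hasDerivAt_id x).add_const a).div
    (((hasDerivAt_id x).const_mul (conj a)).const_add 1) (one_add_conj_mul_ne_zero ha hx)
  have e : (((1 - ‖a‖ ^ 2 : ℝ) : ℂ) / (1 + conj a * x) ^ 2) =
      (1 * (1 + conj a * id x) - (id x + a) * (conj a * 1)) / (1 + conj a * id x) ^ 2 := by
    push_cast
    rw [← Complex.conj_mul' a]
    simp only [id]
    ring
  rw [e]
  exact h

/-- The Schwarz–Pick lemma at the origin. -/
theorem norm_deriv_le_one_sub_sq_of_mapsTo_ball {F : ℂ → ℂ}
    (hd : DifferentiableOn ℂ F (ball 0 1)) (hF : MapsTo F (ball 0 1) (ball 0 1)) :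
    ‖deriv F 0‖ ≤ 1 - ‖F 0‖ ^ 2 := by
  have hF' : ∀ x ∈ ball (0 : ℂ) 1, ‖F x‖ < 1 := fun x hx => by simpa using hF hx
  have h0 : (0 : ℂ) ∈ ball (0 : ℂ) 1 := by simp
  have hF0 := hF' 0 h0
  have hn : ‖-F 0‖ < 1 := by rwa [norm_neg]
  have hpos : 0 < 1 - ‖F 0‖ ^ 2 := by nlinarith [norm_nonneg (F 0)]
  have hG0 : diskShift (-F 0) (F 0) = 0 := by simp [diskShift]
  -- Composing with the automorphism that sends `F 0` to 0 reduces to the Schwarz lemma.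
  have hG := Complex.norm_deriv_le_one_of_mapsTo_ball (f := diskShift (-F 0) ∘ F) (c := 0) (R := 1)
    (fun x hx => ((hasDerivAt_diskShift hn (hF' x hx)).differentiableAt.comp x
      (hd.differentiableAt (isOpen_ball.mem_nhds hx))).differentiableWithinAt)
    (fun x hx => by
      simpa [hG0] using (norm_diskShift_lt_one hn (hF' x hx)).le) one_pos
  rw [((hasDerivAt_diskShift hn hF0).comp 0
    (hd.differentiableAt (isOpen_ball.mem_nhds h0)).hasDerivAt).deriv, norm_mul] at hG
  have e : 1 + conj (-F 0) * F 0 = ((1 - ‖F 0‖ ^ 2 : ℝ) : ℂ) := by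
    push_cast
    rw [← Complex.conj_mul' (F 0), map_neg]
    ring
  rw [e, norm_neg, norm_div, norm_pow, Complex.norm_real, Real.norm_of_nonneg hpos.le,
    div_mul_eq_mul_div, div_le_one (by positivity), pow_two (1 - ‖F 0‖ ^ 2)] at hG
  exact le_of_mul_le_mul_left hG hpos

/-- The Schwarz–Pick lemma for a holomorphic map `p` of the unit disk into `Ω`: it does not increase
hyperbolic length at the origin. -/
theorem norm_deriv_mul_hyperbolicDensity_le_one {Ω : Set ℂ} (hΩ : IsOpen Ω) {p : ℂ → ℂ}
    (hd : DifferentiableOn ℂ p (ball 0 1)) (hp : MapsTo p (ball 0 1) Ω) :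
    ‖deriv p 0‖ * hyperbolicDensity Ω (p 0) ≤ 1 := by
  unfold hyperbolicDensity
  split_ifs with h
  -- Only that φ maps Ω holomorphically into the disk is used, so independence of the choice of φ is
  -- not needed.
  · obtain ⟨hφ, hbij⟩ := h.choose_spec
    set φ := h.choose
    have h0 : (0 : ℂ) ∈ ball (0 : ℂ) 1 := by simp
    have h1 := norm_deriv_le_one_sub_sq_of_mapsTo_ball (hφ.comp hd hp) (hbij.mapsTo.comp hp)
    rw [deriv_comp 0 (hφ.differentiableAt (hΩ.mem_nhds (hp h0)))
      (hd.differentiableAt (isOpen_ball.mem_nhds h0)), norm_mul, Function.comp_apply] at h1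
    have h2 : ‖φ (p 0)‖ < 1 := by simpa using hbij.mapsTo (hp h0)
    have hpos : 0 < 1 - ‖φ (p 0)‖ ^ 2 := by nlinarith [norm_nonneg (φ (p 0))]
    rw [diskDensity, one_div_mul_eq_div, mul_div_assoc', div_le_one hpos]
    linarith
  · simp

/-! ### The disks `Ω_γ` -/

theorem isOpen_shiftedDisk (γ : ℝ) : IsOpen (shiftedDisk γ) :=
  isOpen_lt (by fun_prop) continuous_const

theorem mem_shiftedDisk_iff {γ : ℝ} (hγ : γ < 1) {z : ℂ} :
    z ∈ shiftedDisk γ ↔ ‖(1 - γ) * z + γ‖ < 1 := by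
  have h1 : 0 < 1 - γ := by linarith
  have h1' : (1 - γ : ℂ) ≠ 0 := by exact_mod_cast h1.ne'
  have e : (1 - γ) * z + γ = ((1 - γ : ℝ) : ℂ) * (z + ((γ / (1 - γ) : ℝ) : ℂ)) := by
    push_cast
    field_simp
  rw [e, norm_mul, Complex.norm_real, Real.norm_of_nonneg h1.le, shiftedDisk, mem_ofPred_eq,
    lt_div_iff₀ h1, mul_comm]

theorem norm_one_sub_mul_add_le {γ : ℝ} (h0 : 0 ≤ γ) (h1 : γ < 1) (z : ℂ) :
    ‖(1 - γ) * z + γ‖ ≤ (1 - γ) * ‖z‖ + γ := by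
  refine (norm_add_le _ _).trans_eq ?_
  rw [norm_mul, Complex.norm_real, Real.norm_of_nonneg h0, ← Complex.ofReal_one,
    ← Complex.ofReal_sub, Complex.norm_real, Real.norm_of_nonneg (by linarith)]

theorem ball_subset_shiftedDisk {γ : ℝ} (h0 : 0 ≤ γ) (h1 : γ < 1) :
    ball (0 : ℂ) 1 ⊆ shiftedDisk γ := by
  intro z hz
  rw [mem_shiftedDisk_iff h1]
  refine (norm_one_sub_mul_add_le h0 h1 z).trans_lt ?_
  have : ‖z‖ < 1 := by simpa using hz
  nlinarith

theorem shiftedDisk_zero : shiftedDisk 0 = ball (0 : ℂ) 1 := by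
  ext z
  simp [shiftedDisk]

/-- The affine map z ↦ (1-γ)z + γ carries Ω_γ onto the unit disk. Its inverse after `diskShift w`
sends 0 to z with derivative (1-|w|²)/(1-γ), and Schwarz–Pick applies. -/
theorem hyperbolicDensity_shiftedDisk_le {γ : ℝ} (hγ : γ < 1) {z : ℂ} (hz : z ∈ shiftedDisk γ) :
    hyperbolicDensity (shiftedDisk γ) z ≤ (1 - γ) / (1 - ‖(1 - γ) * z + γ‖ ^ 2) := by
  have h1 : 0 < 1 - γ := by linarith
  have h1' : (1 - γ : ℂ) ≠ 0 := by exact_mod_cast h1.ne'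
  set w : ℂ := (1 - γ) * z + γ with hw
  have hw1 : ‖w‖ < 1 := (mem_shiftedDisk_iff hγ).1 hz
  have hpos : 0 < 1 - ‖w‖ ^ 2 := by nlinarith [norm_nonneg w]
  have hder (x : ℂ) (hx : x ∈ ball (0 : ℂ) 1) :
      HasDerivAt (fun x => (diskShift w x - γ) / (1 - γ))
        (((1 - ‖w‖ ^ 2 : ℝ) : ℂ) / (1 + conj w * x) ^ 2 / (1 - γ)) x :=
    ((hasDerivAt_diskShift hw1 (by simpa using hx)).sub_const _).div_const _
  have h := norm_deriv_mul_hyperbolicDensity_le_one (isOpen_shiftedDisk γ)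
    (p := fun x => (diskShift w x - γ) / (1 - γ))
    (fun x hx => (hder x hx).differentiableAt.differentiableWithinAt)
    (fun x hx => by
      rw [mem_shiftedDisk_iff hγ, mul_div_cancel₀ _ h1', sub_add_cancel]
      exact norm_diskShift_lt_one hw1 (by simpa using hx))
  have hz0 : (diskShift w 0 - γ) / (1 - γ) = z := by
    simp only [diskShift, mul_zero, add_zero, zero_add, div_one, hw, add_sub_cancel_right]
    exact mul_div_cancel_left₀ z h1'
  rw [(hder 0 (by simp)).deriv, hz0, mul_zero, add_zero, one_pow, div_one, norm_div,
    Complex.norm_real, Real.norm_of_nonneg hpos.le, ← Complex.ofReal_one, ← Complex.ofReal_sub,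
    Complex.norm_real, Real.norm_of_nonneg h1.le, div_mul_eq_mul_div, div_le_one h1] at h
  rw [le_div_iff₀ hpos]
  linarith

theorem hyperbolicDensity_shiftedDisk_circleMap_le {γ : ℝ} (h0 : 0 ≤ γ) (h1 : γ < 1) {t : ℝ}
    (ht : t ∈ Ioo (0 : ℝ) 1) (θ : ℝ) :
    hyperbolicDensity (shiftedDisk γ) (circleMap 0 t θ) ≤
      (1 - γ) / (1 - ((1 - γ) * t + γ) ^ 2) := by
  have hz := ball_subset_shiftedDisk h0 h1 (circleMap_mem_ball_one ht θ)
  refine (hyperbolicDensity_shiftedDisk_le h1 hz).trans ?_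
  have h2 := norm_one_sub_mul_add_le h0 h1 (circleMap 0 t θ)
  rw [norm_circleMap_zero, abs_of_pos ht.1] at h2
  have h3 : 0 ≤ (1 - γ) * t := mul_nonneg (by linarith) ht.1.le
  have h4 : (1 - γ) * t + γ < 1 := by nlinarith [ht.2]
  refine div_le_div_of_nonneg_left (by linarith) (by nlinarith) ?_
  gcongr

theorem sq_norm_coeff_add_le_coeffBoundShifted {γ : ℝ} (h0 : 0 ≤ γ) (h1 : γ < 1)
    {α M : ℝ} (hα : 0 < α) (hM : 0 < M) {f h g : ℂ → ℂ} {a b : ℕ → ℂ}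
    (hB : blochNorm (shiftedDisk γ) α f h g ≤ ENNReal.ofReal M)
    (ha : HasDiskExpansion h a) (hb : HasDiskExpansion g b) {n : ℕ} (hn : 1 ≤ n) :
    (‖a n‖ + ‖b n‖) ^ 2 ≤ coeffBoundShifted α γ M n := by
  obtain ⟨k, rfl⟩ := Nat.exists_eq_add_of_le' hn
  refine le_mul_iInf_Ioo (F := fun t => (1 - γ) ^ (2 * α) /
      (t ^ (2 * (k + 1 - 1)) * (1 - ((1 - γ) * t + γ) ^ 2) ^ (2 * α))) (by positivity) ?_
  intro t ht
  have ht0 : 0 < t := ht.1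
  have hpi : 0 < 2 * Real.pi := by positivity
  have hsub := ball_subset_shiftedDisk h0 h1
  have hmain := sq_norm_coeff_add_le (isOpen_shiftedDisk γ) hsub hα hM hB ha hb ht k
  have h3 : 0 ≤ (1 - γ) * t := mul_nonneg (by linarith) ht.1.le
  have h4 : (1 - γ) * t + γ < 1 := by nlinarith [ht.2]
  have h5 : 0 < 1 - ((1 - γ) * t + γ) ^ 2 := by nlinarith
  have hint : (2 * Real.pi)⁻¹ * ∫ θ in (0 : ℝ)..(2 * Real.pi),
      hyperbolicDensity (shiftedDisk γ) (circleMap 0 t θ) ^ (2 * α) ≤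
      ((1 - γ) / (1 - ((1 - γ) * t + γ) ^ 2)) ^ (2 * α) := by
    rw [inv_mul_le_iff₀ hpi]
    refine (intervalIntegral.integral_mono_on hpi.le
      ((continuous_hyperbolicDensity_circleMap_rpow (isOpen_shiftedDisk γ) hsub ht
        (by positivity)).intervalIntegrable _ _) intervalIntegrable_const fun θ _ =>
      Real.rpow_le_rpow (hyperbolicDensity_nonneg (hsub (circleMap_mem_ball_one ht θ)))
        (hyperbolicDensity_shiftedDisk_circleMap_le h0 h1 ht θ) (by positivity)).trans_eq ?_
    simp
  have h6 := hmain.trans (mul_le_mul_of_nonneg_left hint (sq_nonneg M))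
  rw [Real.div_rpow (by linarith) h5.le] at h6
  set A := (1 - γ) ^ (2 * α)
  have hB0 : 0 < (1 - ((1 - γ) * t + γ) ^ 2) ^ (2 * α) := Real.rpow_pos_of_pos h5 _
  set B := (1 - ((1 - γ) * t + γ) ^ 2) ^ (2 * α)
  have hk : (0 : ℝ) < k + 1 := by positivity
  have e : M ^ 2 / ((k + 1 : ℕ) : ℝ) ^ 2 * (A / (t ^ (2 * (k + 1 - 1)) * B)) =
      M ^ 2 * (A / B) / ((k + 1) * t ^ k) ^ 2 := by
    rw [Nat.add_sub_cancel, pow_mul']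
    push_cast
    field_simp
  rw [e, le_div_iff₀ (by positivity)]
  linarith

/-! ### The bounds for the unit disk -/

theorem coeffBoundShifted_zero_integrand_nonneg (α : ℝ) (n : ℕ) (t : Ioo (0 : ℝ) 1) :
    0 ≤ (1 - 0 : ℝ) ^ (2 * α) /
      ((t : ℝ) ^ (2 * (n - 1)) * (1 - ((1 - 0) * (t : ℝ) + 0) ^ 2) ^ (2 * α)) := by
  obtain ⟨t, ht0, ht1⟩ := t
  have : 0 ≤ 1 - ((1 - 0) * t + 0) ^ 2 := by nlinarith
  dsimp only
  have := Real.rpow_nonneg this (2 * α)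
  positivity

theorem coeffBoundShifted_zero_nonneg (α M : ℝ) (n : ℕ) : 0 ≤ coeffBoundShifted α 0 M n :=
  mul_nonneg (by positivity) (Real.iInf_nonneg (coeffBoundShifted_zero_integrand_nonneg α n))

theorem coeffBoundShifted_zero_le (α M : ℝ) (n : ℕ) {t : ℝ} (ht : t ∈ Ioo (0 : ℝ) 1) :
    coeffBoundShifted α 0 M n ≤
      M ^ 2 / (n : ℝ) ^ 2 * (1 / (t ^ (2 * (n - 1)) * (1 - t ^ 2) ^ (2 * α))) := by
  refine mul_le_mul_of_nonneg_left ((ciInf_le ⟨0, ?_⟩ (⟨t, ht⟩ : Ioo (0 : ℝ) 1)).trans_eq ?_)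
    (by positivity)
  · rintro _ ⟨s, rfl⟩
    exact coeffBoundShifted_zero_integrand_nonneg α n s
  · simp

theorem coeffBoundShifted_zero_one_le (α M : ℝ) : coeffBoundShifted α 0 M 1 ≤ M ^ 2 := by
  have h : Tendsto (fun t : ℝ => M ^ 2 * (1 / (1 - t ^ 2) ^ (2 * α))) (𝓝[>] 0)
      -- For n = 1 the optimal radius is the excluded endpoint t = 0, so the bound is reached as a
      -- limit.
      (𝓝 (M ^ 2 * (1 / (1 - (0 : ℝ) ^ 2) ^ (2 * α)))) := by
    refine ContinuousAt.tendsto (f := fun t : ℝ => M ^ 2 * (1 / (1 - t ^ 2) ^ (2 * α))) ?_ |>.mono_left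
      nhdsWithin_le_nhds
    refine continuousAt_const.mul (continuousAt_const.div
      (ContinuousAt.rpow_const (by fun_prop) (Or.inl (by norm_num))) (by norm_num))
  have h1 : M ^ 2 * (1 / (1 - (0 : ℝ) ^ 2) ^ (2 * α)) = M ^ 2 := by norm_num
  rw [h1] at h
  refine ge_of_tendsto h ?_
  filter_upwards [Ioo_mem_nhdsGT (zero_lt_one (α := ℝ))] with t ht
  simpa using coeffBoundShifted_zero_le α M 1 ht

theorem coeffBoundShifted_zero_le_explicitDiskBound {α : ℝ} (hα : 0 < α) (M : ℝ) {n : ℕ}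
    (hn : 1 ≤ n) : coeffBoundShifted α 0 M n ≤ explicitDiskBound α M n := by
  obtain rfl | ⟨k, rfl⟩ : n = 1 ∨ ∃ k, n = k + 1 + 1 := by
    rcases n with _ | _ | k
    · omega
    · simp
    · exact Or.inr ⟨k, rfl⟩
  · refine (coeffBoundShifted_zero_one_le α M).trans_eq ?_
    -- At n = 1 the quotient 2α/0 is 0 by convention and its power has exponent 0, so the bound is
    -- M².
    have : (2 * α) ^ (2 * α) ≠ 0 := (Real.rpow_pos_of_pos (by positivity) _).ne'
    simp [explicitDiskBound, this]
  · set m : ℝ := ((k + 1 : ℕ) : ℝ) with hm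
    have hm0 : 0 < m := by rw [hm]; positivity
    have hq0 : 0 < m / (m + 2 * α) := by positivity
    have hq1 : m / (m + 2 * α) < 1 := by
      rw [div_lt_one (by positivity)]
      linarith
    -- With m = n-1, this t maximizes t^(2m)(1-t²)^(2α).
    have ht : √(m / (m + 2 * α)) ∈ Ioo (0 : ℝ) 1 :=
      ⟨Real.sqrt_pos.2 hq0, by rw [Real.sqrt_lt' one_pos]; simpa using hq1⟩
    refine (coeffBoundShifted_zero_le α M _ ht).trans_eq ?_
    have e1 : 1 - m / (m + 2 * α) = 2 * α / (m + 2 * α) := by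
      field_simp
      ring
    have e2 : ((k + 1 + 1 : ℕ) : ℝ) - 1 = m := by
      rw [hm]
      push_cast
      ring
    have e3 : 1 + 2 * α / m = (m + 2 * α) / m := by
      field_simp
    rw [explicitDiskBound, pow_mul, Real.sq_sqrt hq0.le, e1, e2, e3, Nat.add_sub_cancel,
      Real.div_rpow (by positivity) (by positivity), div_pow, div_pow]
    have : 0 < (2 * α) ^ (2 * α) := Real.rpow_pos_of_pos (by positivity) _
    have : 0 < (m + 2 * α) ^ (2 * α) := Real.rpow_pos_of_pos (by positivity) _
    field_simp

theorem explicitDiskBound_nonneg {α : ℝ} (hα : 0 < α) (M : ℝ) {n : ℕ} (hn : 1 ≤ n) :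
    0 ≤ explicitDiskBound α M n := by
  have : (0 : ℝ) ≤ (n : ℝ) - 1 := by
    have : (1 : ℝ) ≤ n := by exact_mod_cast hn
    linarith
  unfold explicitDiskBound
  positivity

theorem explicitDiskBound_le {α : ℝ} (hα : 0 < α) (M : ℝ) {n : ℕ} (hn : 2 ≤ n) :
    explicitDiskBound α M n ≤
      M ^ 2 / (2 * α) ^ (2 * α) * Real.exp (2 * α) * (1 + 2 * α) ^ (2 * α) *
        (n : ℝ) ^ (2 * α - 2) := by
  have hn' : (2 : ℝ) ≤ n := by exact_mod_cast hn
  have hm : (0 : ℝ) < (n : ℝ) - 1 := by linarith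
  have h1 : (1 + 2 * α / ((n : ℝ) - 1)) ^ (n - 1) ≤ Real.exp (2 * α) := by
    have h2 : 1 + 2 * α / ((n : ℝ) - 1) ≤ Real.exp (2 * α / ((n : ℝ) - 1)) := by
      linarith [Real.add_one_le_exp (2 * α / ((n : ℝ) - 1))]
    refine (pow_le_pow_left₀ (by positivity) h2 _).trans_eq ?_
    rw [← Real.exp_nat_mul, Nat.cast_sub (by omega), Nat.cast_one, mul_div_cancel₀ _ hm.ne']
  -- Uses n - 1 + 2α ≤ (1 + 2α)n.
  have h3 : ((n : ℝ) - 1 + 2 * α) ^ (2 * α) ≤ (1 + 2 * α) ^ (2 * α) * (n : ℝ) ^ (2 * α) := by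
    rw [← Real.mul_rpow (by positivity) (by positivity)]
    exact Real.rpow_le_rpow (by positivity) (by nlinarith) (by positivity)
  have h4 : (n : ℝ) ^ (2 * α - 2) = (n : ℝ) ^ (2 * α) / (n : ℝ) ^ 2 := by
    rw [Real.rpow_sub (by positivity)]
    norm_num
  rw [h4, explicitDiskBound, mul_assoc _ ((1 + 2 * α) ^ (2 * α)),
    ← mul_div_assoc ((1 + 2 * α) ^ (2 * α))]
  exact mul_le_mul (mul_le_mul_of_nonneg_left h1 (by positivity))
    (div_le_div_of_nonneg_right h3 (sq_nonneg _)) (by positivity) (by positivity)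

theorem explicitDiskBound_isBigO {α : ℝ} (hα : 0 < α) (M : ℝ) :
    (fun n : ℕ => explicitDiskBound α M n) =O[atTop] fun n : ℕ => (n : ℝ) ^ (2 * α - 2) := by
  refine Asymptotics.IsBigO.of_bound
    (M ^ 2 / (2 * α) ^ (2 * α) * Real.exp (2 * α) * (1 + 2 * α) ^ (2 * α)) ?_
  filter_upwards [eventually_ge_atTop 2] with n hn
  rw [Real.norm_of_nonneg (explicitDiskBound_nonneg hα M (by omega)),
    Real.norm_of_nonneg (by positivity)]
  exact explicitDiskBound_le hα M hn

theorem coeffBoundShifted_zero_isBigO {α : ℝ} (hα : 0 < α) (M : ℝ) :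
    (fun n : ℕ => coeffBoundShifted α 0 M n) =O[atTop] fun n : ℕ => (n : ℝ) ^ (2 * α - 2) := by
  refine Asymptotics.IsBigO.trans (.of_bound' ?_) (explicitDiskBound_isBigO hα M)
  filter_upwards [eventually_ge_atTop 1] with n hn
  rw [Real.norm_of_nonneg (coeffBoundShifted_zero_nonneg α M n),
    Real.norm_of_nonneg (explicitDiskBound_nonneg hα M hn)]
  exact coeffBoundShifted_zero_le_explicitDiskBound hα M hn

/-! ### The main theorem -/

theorem theorem3p5 (α M : ℝ) (hα : 0 < α) (hM : 0 < M) :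
    -- proper simply connected domains containing the unit disk
    (∀ Ω : Set ℂ, IsOpen Ω → IsSimplyConnected Ω → Ω ≠ univ → ball (0 : ℂ) 1 ⊆ Ω →
      (∀ t ∈ Ioo (0 : ℝ) 1, IntervalIntegrable
        (fun θ : ℝ => hyperbolicDensity Ω (circleMap 0 t θ) ^ (2 * α)) volume 0 (2 * Real.pi)) ∧
      ∀ (f h g : ℂ → ℂ) (a b : ℕ → ℂ), IsHarmonicMapping Ω f h g → f 0 = 0 →
        blochNorm Ω α f h g ≤ ENNReal.ofReal M → HasDiskExpansion h a → HasDiskExpansion g b →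
        ∀ n : ℕ, 1 ≤ n →
          ‖a n‖ ^ 2 + ‖b n‖ ^ 2 ≤ coeffBound Ω α M n ∧
          ‖a n‖ + ‖b n‖ ≤ √(2 * coeffBound Ω α M n)) ∧
    -- the disks `Ω_γ`
    (∀ γ : ℝ, 0 ≤ γ → γ < 1 →
      ∀ (f h g : ℂ → ℂ) (a b : ℕ → ℂ), IsHarmonicMapping (shiftedDisk γ) f h g → f 0 = 0 →
        blochNorm (shiftedDisk γ) α f h g ≤ ENNReal.ofReal M →
        HasDiskExpansion h a → HasDiskExpansion g b →
        ∀ n : ℕ, 1 ≤ n → ‖a n‖ ^ 2 + ‖b n‖ ^ 2 ≤ coeffBoundShifted α γ M n) ∧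
    -- the unit disk
    (∀ (f h g : ℂ → ℂ) (a b : ℕ → ℂ), IsHarmonicMapping (ball (0 : ℂ) 1) f h g → f 0 = 0 →
      blochNorm (ball (0 : ℂ) 1) α f h g ≤ ENNReal.ofReal M →
      HasDiskExpansion h a → HasDiskExpansion g b →
      ∀ n : ℕ, 1 ≤ n → ‖a n‖ ^ 2 + ‖b n‖ ^ 2 ≤ coeffBoundShifted α 0 M n) ∧
    (α < 1 → Tendsto (fun n : ℕ => coeffBoundShifted α 0 M n) atTop (𝓝 0)) ∧
    (1 ≤ α →
      (∀ n : ℕ, 1 ≤ n → coeffBoundShifted α 0 M n ≤ explicitDiskBound α M n) ∧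
      (fun n : ℕ => explicitDiskBound α M n) =O[atTop] (fun n : ℕ => (n : ℝ) ^ (2 * α - 2)) ∧
      (fun n : ℕ => coeffBoundShifted α 0 M n) =O[atTop]
        (fun n : ℕ => (n : ℝ) ^ (2 * α - 2))) := by
  refine ⟨fun Ω hΩ _ _ hsub => ⟨fun t ht => ?_, ?_⟩, ?_, ?_, ?_, ?_⟩
  · exact (continuous_hyperbolicDensity_circleMap_rpow hΩ hsub ht
      (by positivity)).intervalIntegrable _ _
  · intro f h g a b _ _ hB ha hb n hn
    have hmain := sq_norm_coeff_add_le_coeffBound hΩ hsub hα hM hB ha hb hn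
    have hsq := (sq_add_sq_le_sq_norm_add (a n) (b n)).trans hmain
    exact ⟨hsq, Real.le_sqrt_of_sq_le (by nlinarith [sq_nonneg (‖a n‖ + ‖b n‖)])⟩
  · intro γ h0 h1 f h g a b _ _ hB ha hb n hn
    exact (sq_add_sq_le_sq_norm_add _ _).trans
      (sq_norm_coeff_add_le_coeffBoundShifted h0 h1 hα hM hB ha hb hn)
  · intro f h g a b _ _ hB ha hb n hn
    rw [← shiftedDisk_zero] at hB
    exact (sq_add_sq_le_sq_norm_add _ _).trans
      (sq_norm_coeff_add_le_coeffBoundShifted le_rfl one_pos hα hM hB ha hb hn)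
  · intro hα1
    -- The order n^(2α-2) holds for every α > 0, and its exponent is negative here.
    refine (coeffBoundShifted_zero_isBigO hα M).trans_tendsto ?_
    have h := (tendsto_rpow_neg_atTop (y := 2 - 2 * α) (by linarith)).comp
      (tendsto_natCast_atTop_atTop (R := ℝ))
    simpa [Function.comp_def] using h
  · exact fun _ => ⟨fun n hn => coeffBoundShifted_zero_le_explicitDiskBound hα M hn,
      explicitDiskBound_isBigO hα M, coeffBoundShifted_zero_isBigO hα M⟩
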